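/- Let $E$ be a real Banach space, with dual $E^*$ and bidual $E^{**}$. Write $\ell_2^+$ (respectively $c_0^+$) for the set of sequences $(\lambda_n)_{n\in\mathbb{N}}$ of non-negative real numbers in $\ell_2$ (respectively $c_0$). For $1\le p<\infty$, a sequence $(x_n^*)$ in $E^*$ is called weakly $p$-summable if $\sum_{n}|\varphi(x_n^*)|^p<\infty$ for every $\varphi\in E^{**}$. The following conditions are equivalent: (a) For every $(\lambda_n)\in\ell_2^+$, $E^*$ contains a weakly $1$-summable sequence $(x_n^*)$ such that $\|x_n^*\|=\lambda_n$ for each $n\in\mathbb{N}$ and the subspace $\bigcup_{m\in\mathbb{N}}\bigcap_{n=m}^\infty\ker x_n^*$ is dense in $E$. (b) For every $(\lambda_n)\in c_0^+$, $E^*$ contains a weakly $2$-summable sequence $(x_n^*)$ such that $\|x_n^*\|=\lambda_n$ for each $n\in\mathbb{N}$ and the subspace $\bigcup_{m\in\mathbb{N}}\bigcap_{n=m}^\infty\ker x_n^*$ is dense in $E$. (c) $E^*$ contains a sequence $(x_n^*)$ of linearly independent functionals such that the subspace $\bigcup_{m\in\mathbb{N}}\bigcap_{n=m}^\infty\ker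 x_n^*$ is dense in $E$. (d) $E^*$ contains a sequence $(x_n^*)$ of non-zero functionals such that the subspace $\bigcup_{m\in\mathbb{N}}\bigcap_{n=m}^\infty\ker x_n^*$ is dense in $E$. (e) $E$ admits an infinite-dimensional, separable quotient space; that is, there is a closed subspace $W$ of $E$ such that $E/W$ is separable and infinite-dimensional. -/

import Mathlib

open Set Filter Topology
open scoped ENNReal

/-- A sequence `x` in a normed space `X` is weakly `p`-summable if the scalar sequence `(φ (x n))`
belongs to `ℓ_p` for every continuous linear functional `φ` on `X`. (For `X = E*` the functionals
`φ` run through the whole bidual `E**`.) -/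
def WeaklySummable {X : Type*} [NormedAddCommGroup X] [NormedSpace ℝ X]
    (p : ℝ≥0∞) (x : ℕ → X) : Prop :=
  ∀ φ : StrongDual ℝ X, Memℓp (fun n => φ (x n)) p

/-- The union over `m` of the intersections over `n ≥ m` of the kernels of the functionals `f n`. -/
def eventualKernel {E : Type*} [NormedAddCommGroup E] [NormedSpace ℝ E]
    (f : ℕ → StrongDual ℝ E) : Set E :=
  ⋃ m : ℕ, ⋂ n : ℕ, ⋂ _ : m ≤ n, {x : E | f n x = 0}

/-- `E` admits an infinite-dimensional, separable quotient space: there is a closed subspace `W`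
such that the quotient `E ⧸ W` is separable and infinite-dimensional. -/
def HasInfiniteDimensionalSeparableQuotient
    (E : Type*) [NormedAddCommGroup E] [NormedSpace ℝ E] : Prop :=
  ∃ W : Submodule ℝ E, IsClosed (W : Set E) ∧
    TopologicalSpace.SeparableSpace (E ⧸ W) ∧ ¬ FiniteDimensional ℝ (E ⧸ W)

/-! (d) ⇒ (e): let `W` be the common kernel of the `f n`. The image in `E ⧸ W` of the common kernel
of the `f n` with `n ≥ m` is finite-dimensional, and these images increase to a dense subspace, so
`E ⧸ W` is separable. Were it finite-dimensional, the images would stabilise at the whole quotient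
and some `f m` would vanish. (e) ⇒ (a), (b), (c): functionals killing `W` and the first `k` lifts of
a dense sequence of `E ⧸ W` form decreasing infinite-dimensional spaces `F k`, and any sequence
eventually in every `F k` has dense eventual kernel (`exists_submodules`). An independent choice
gives (c). For (a) and (b), Dvoretzky-Rogers puts in each `F k` as many unit vectors as desired with
`∑ φ (x i) ^ 2 ≤ 9 * ‖φ‖ ^ 2`; moving slowly through the `F k` lets the decay of `c` pay for the
number of blocks. -/

section DvoretzkyRogers

/-! ### Dvoretzky-Rogers via ellipsoids of maximal volume. -/

open Module

theorem exists_contraction_maximal_det {H V : Type*} [NormedAddCommGroup H]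
    [InnerProductSpace ℝ H] [FiniteDimensional ℝ H] [NormedAddCommGroup V] [NormedSpace ℝ V]
    (e : H ≃L[ℝ] V) :
    ∃ A : H →L[ℝ] H, ‖(e : H →L[ℝ] V).comp A‖ ≤ 1 ∧ 0 < A.det ∧
      ∀ B : H →L[ℝ] H, ‖(e : H →L[ℝ] V).comp B‖ ≤ 1 → B.det ≤ A.det := by
  set S : Set (H →L[ℝ] H) := {A | ‖(e : H →L[ℝ] V).comp A‖ ≤ 1}
  have hS : IsCompact S := by
    refine Metric.isCompact_of_isClosed_isBounded ?_ ?_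
    · exact isClosed_le (by fun_prop) continuous_const
    · refine (Metric.isBounded_closedBall (x := (0 : H →L[ℝ] H))
        (r := ‖(e.symm : V →L[ℝ] H)‖)).subset fun A hA => ?_
      rw [mem_closedBall_zero_iff]
      have h : A = (e.symm : V →L[ℝ] H).comp ((e : H →L[ℝ] V).comp A) := by ext x; simp
      calc ‖A‖ = ‖(e.symm : V →L[ℝ] H).comp ((e : H →L[ℝ] V).comp A)‖ := by rw [← h]
        _ ≤ ‖(e.symm : V →L[ℝ] H)‖ * ‖(e : H →L[ℝ] V).comp A‖ :=
          ContinuousLinearMap.opNorm_comp_le _ _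
        _ ≤ ‖(e.symm : V →L[ℝ] H)‖ := mul_le_of_le_one_right (norm_nonneg _) hA
  have hne : (‖(e : H →L[ℝ] V)‖ + 1)⁻¹ • ContinuousLinearMap.id ℝ H ∈ S := by
    have : 0 ≤ ‖(e : H →L[ℝ] V)‖ := norm_nonneg _
    change ‖(e : H →L[ℝ] V).comp _‖ ≤ 1
    rw [ContinuousLinearMap.comp_smul, ContinuousLinearMap.comp_id, norm_smul, norm_inv,
      Real.norm_of_nonneg (by positivity), inv_mul_le_iff₀ (by positivity)]
    linarith
  obtain ⟨A, hA, hmax⟩ := hS.exists_isMaxOn ⟨_, hne⟩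
    ContinuousLinearMap.continuous_det.continuousOn
  refine ⟨A, hA, lt_of_lt_of_le ?_ (hmax hne), fun B hB => hmax hB⟩
  have : 0 ≤ ‖(e : H →L[ℝ] V)‖ := norm_nonneg _
  change 0 < LinearMap.det ((‖(e : H →L[ℝ] V)‖ + 1)⁻¹ • (LinearMap.id : H →ₗ[ℝ] H))
  rw [LinearMap.det_smul, LinearMap.det_id]
  positivity

theorem det_smul_starProjection_add {H : Type*} [NormedAddCommGroup H]
    [InnerProductSpace ℝ H] [FiniteDimensional ℝ H] (U : Submodule ℝ H) (a b : ℝ) :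
    (b • U.starProjection + a • Uᗮ.starProjection).det =
      b ^ finrank ℝ U * a ^ finrank ℝ Uᗮ := by
  have key : ((b • U.starProjection + a • Uᗮ.starProjection : H →L[ℝ] H) : H →ₗ[ℝ] H) =
      (U.prodEquivOfIsCompl Uᗮ U.isCompl_orthogonal : (U × Uᗮ) →ₗ[ℝ] H) ∘ₗ
        (LinearMap.prodMap (b • LinearMap.id) (a • LinearMap.id)) ∘ₗ
        ((U.prodEquivOfIsCompl Uᗮ U.isCompl_orthogonal).symm : H →ₗ[ℝ] (U × Uᗮ)) := by
    rw [← LinearMap.comp_assoc, LinearEquiv.eq_comp_toLinearMap_symm]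
    ext x
    · simp [Submodule.starProjection_eq_self_iff.2 x.2,
        (Submodule.starProjection_apply_eq_zero_iff (K := Uᗮ)).2
          (U.le_orthogonal_orthogonal x.2)]
    · simp [Submodule.starProjection_eq_self_iff.2 x.2,
        (Submodule.starProjection_apply_eq_zero_iff (K := U)).2 x.2]
  change LinearMap.det _ = _
  rw [key, LinearMap.det_conj, LinearMap.det_prodMap, LinearMap.det_smul, LinearMap.det_smul,
    LinearMap.det_id, LinearMap.det_id, mul_one, mul_one]

/-- Otherwise `T ∘ A` shrinks `U` by 1/3. Stretching `U` by 12/5 and `Uᗮ` by 3/5 keeps a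
contraction, since (12/5)(1/3) = 4/5 and (4/5)² + (3/5)² = 1, yet multiplies the determinant by at
least (36/25) ^ dim `U` because dim `Uᗮ` ≤ dim `U`. -/
theorem exists_norm_ge_of_maximal_det {H V : Type*} [NormedAddCommGroup H]
    [InnerProductSpace ℝ H] [FiniteDimensional ℝ H] [NormedAddCommGroup V] [NormedSpace ℝ V]
    (T : H →L[ℝ] V) {A : H →L[ℝ] H} (hA : ‖T.comp A‖ ≤ 1) (hdet : 0 < A.det)
    (hmax : ∀ B : H →L[ℝ] H, ‖T.comp B‖ ≤ 1 → B.det ≤ A.det)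
    (U : Submodule ℝ H) (hU : finrank ℝ H ≤ 2 * finrank ℝ U) (hpos : 0 < finrank ℝ U) :
    ∃ u ∈ U, ‖u‖ = 1 ∧ 1 / 3 ≤ ‖T (A u)‖ := by
  by_contra! hcon
  have hsmall : ∀ u ∈ U, ‖T (A u)‖ ≤ 1 / 3 * ‖u‖ := by
    intro u hu
    rcases eq_or_ne u 0 with rfl | h0
    · simp
    have hn : 0 < ‖u‖ := norm_pos_iff.2 h0
    have := hcon (‖u‖⁻¹ • u) (U.smul_mem _ hu) (by simp [norm_smul, hn.ne'])
    rw [map_smul, map_smul, norm_smul, norm_inv, norm_norm, inv_mul_lt_iff₀ hn] at this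
    linarith
  have hle := hmax (A.comp ((12 / 5 : ℝ) • U.starProjection + (3 / 5 : ℝ) • Uᗮ.starProjection)) <| by
    refine ContinuousLinearMap.opNorm_le_bound _ zero_le_one fun x => ?_
    have h1 := hsmall (U.starProjection x) (U.starProjection_apply_mem x)
    have h2 := (T.comp A).le_of_opNorm_le hA (Uᗮ.starProjection x)
    have h3 := Submodule.norm_sq_eq_add_norm_sq_starProjection x U
    have h4 : ‖T (A ((12 / 5 : ℝ) • U.starProjection x + (3 / 5 : ℝ) • Uᗮ.starProjection x))‖ ≤
        12 / 5 * ‖T (A (U.starProjection x))‖ + 3 / 5 * ‖T (A (Uᗮ.starProjection x))‖ := by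
      simp only [map_add, map_smul]
      refine (norm_add_le _ _).trans_eq ?_
      rw [norm_smul, norm_smul]
      norm_num
    change ‖T (A ((12 / 5 : ℝ) • U.starProjection x + (3 / 5 : ℝ) • Uᗮ.starProjection x))‖ ≤ _
    change ‖T (A (Uᗮ.starProjection x))‖ ≤ _ at h2
    refine h4.trans ?_
    rw [one_mul]
    refine le_of_sq_le_sq ?_ (norm_nonneg _)
    have h5 : 12 / 5 * ‖T (A (U.starProjection x))‖ + 3 / 5 * ‖T (A (Uᗮ.starProjection x))‖ ≤
      4 / 5 * ‖U.starProjection x‖ + 3 / 5 * ‖Uᗮ.starProjection x‖ := by linarith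
    refine (pow_le_pow_left₀ (by positivity) h5 2).trans ?_
    nlinarith [sq_nonneg (3 * ‖U.starProjection x‖ - 4 * ‖Uᗮ.starProjection x‖)]
  have hcomp : (A.comp ((12 / 5 : ℝ) • U.starProjection + (3 / 5 : ℝ) • Uᗮ.starProjection)).det =
      A.det * ((12 / 5 : ℝ) ^ finrank ℝ U * (3 / 5 : ℝ) ^ finrank ℝ Uᗮ) := by
    rw [← det_smul_starProjection_add]
    exact LinearMap.det_comp _ _
  rw [hcomp] at hle
  have hfin : finrank ℝ Uᗮ ≤ finrank ℝ U := by
    have := U.finrank_add_finrank_orthogonal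
    omega
  have h1 : (1 : ℝ) < (12 / 5 : ℝ) ^ finrank ℝ U * (3 / 5 : ℝ) ^ finrank ℝ Uᗮ := by
    calc (1 : ℝ) < (36 / 25 : ℝ) ^ finrank ℝ U := one_lt_pow₀ (by norm_num) hpos.ne'
      _ = (12 / 5 : ℝ) ^ finrank ℝ U * (3 / 5 : ℝ) ^ finrank ℝ U := by
        rw [← mul_pow]; norm_num
      _ ≤ _ := mul_le_mul_of_nonneg_left
        (pow_le_pow_of_le_one (by norm_num) (by norm_num) hfin) (by positivity)
  nlinarith

/-- Greedy choice: the orthogonal complement of fewer than `N` vectors in dimension `2 * N` still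
has dimension above `N`. -/
theorem exists_orthonormal_of_forall_submodule {H : Type*} [NormedAddCommGroup H]
    [InnerProductSpace ℝ H] [FiniteDimensional ℝ H] (p : H → Prop) (N : ℕ)
    (hN : finrank ℝ H = 2 * N)
    (hp : ∀ U : Submodule ℝ H, N ≤ finrank ℝ U → 0 < finrank ℝ U → ∃ u ∈ U, ‖u‖ = 1 ∧ p u) :
    ∃ u : Fin N → H, Orthonormal ℝ u ∧ ∀ i, p (u i) := by
  suffices h : ∀ k ≤ N, ∃ u : Fin k → H, Orthonormal ℝ u ∧ ∀ i, p (u i) from h N le_rfl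
  intro k
  induction k with
  | zero => exact fun _ => ⟨Fin.elim0, ⟨fun i => i.elim0, fun i => i.elim0⟩, fun i => i.elim0⟩
  | succ k ih =>
    intro hk
    obtain ⟨u, hu, hpu⟩ := ih (by omega)
    set W : Submodule ℝ H := Submodule.span ℝ (Set.range u)
    have hW : finrank ℝ W = k := by
      simpa using finrank_span_eq_card hu.linearIndependent
    have hW' := W.finrank_add_finrank_orthogonal
    obtain ⟨v, hv, hv1, hpv⟩ := hp Wᗮ (by omega) (by omega)
    have hperp : ∀ i, inner ℝ (u i) v = 0 := fun i =>
      (Submodule.mem_orthogonal _ _).1 hv _ (Submodule.subset_span ⟨i, rfl⟩)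
    refine ⟨Fin.snoc u v, ⟨?_, ?_⟩, ?_⟩
    · intro i
      refine Fin.lastCases ?_ (fun i => ?_) i
      · simpa using hv1
      · simpa using hu.1 i
    · intro i j
      refine Fin.lastCases ?_ (fun i => ?_) i <;> refine Fin.lastCases ?_ (fun j => ?_) j
      · simp
      · intro _
        simpa [real_inner_comm] using hperp j
      · intro _
        simpa using hperp i
      · intro hij
        simpa using hu.2 (fun h => hij (congrArg _ h))
    · intro i
      refine Fin.lastCases ?_ (fun i => ?_) i
      · simpa using hpv
      · simpa using hpu i

/-- A form of the Dvoretzky-Rogers lemma. -/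
theorem exists_unit_vectors_sum_sq_le {X : Type*} [NormedAddCommGroup X] [NormedSpace ℝ X]
    (hX : ¬ FiniteDimensional ℝ X) (N : ℕ) :
    ∃ x : Fin N → X, (∀ i, ‖x i‖ = 1) ∧
      ∀ φ : StrongDual ℝ X, ∑ i, φ (x i) ^ 2 ≤ 9 * ‖φ‖ ^ 2 := by
  obtain ⟨v, hv⟩ : ∃ v : Fin (2 * N) → X, LinearIndependent ℝ v := by
    refine exists_linearIndependent_of_le_rank ?_
    refine (Cardinal.natCast_lt_aleph0).le.trans ?_
    rw [← not_lt, Module.rank_lt_aleph0_iff]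
    exact hX
  set V : Submodule ℝ X := Submodule.span ℝ (Set.range v)
  have hV : finrank ℝ V = 2 * N := by simpa using finrank_span_eq_card hv
  have : FiniteDimensional ℝ V := FiniteDimensional.span_of_finite ℝ (Set.finite_range v)
  let H := EuclideanSpace ℝ (Fin (2 * N))
  have hH : finrank ℝ H = 2 * N := by simp [H]
  let e : H ≃L[ℝ] V := ContinuousLinearEquiv.ofFinrankEq (hH.trans hV.symm)
  obtain ⟨A, hA, hdet, hmax⟩ := exists_contraction_maximal_det e
  obtain ⟨u, hu, hpu⟩ := exists_orthonormal_of_forall_submodule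
    (fun u : H => 1 / 3 ≤ ‖e (A u)‖) N hH
    (fun U hU hpos => exists_norm_ge_of_maximal_det (e : H →L[ℝ] V) hA hdet hmax U (by omega) hpos)
  have hn : ∀ i, 0 < ‖e (A (u i))‖ := fun i => lt_of_lt_of_le (by norm_num) (hpu i)
  refine ⟨fun i => ‖e (A (u i))‖⁻¹ • (e (A (u i)) : X), fun i => ?_, fun φ => ?_⟩
  · rw [norm_smul, norm_inv, norm_norm, Submodule.norm_coe]
    exact inv_mul_cancel₀ (hn i).ne'
  -- Bessel's inequality for `ψ`; normalising vectors of norm at least 1/3 costs the factor 9.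
  · set ψ : StrongDual ℝ H := (φ.comp V.subtypeL).comp ((e : H →L[ℝ] V).comp A)
    have hψ : ‖ψ‖ ≤ ‖φ‖ := by
      calc ‖ψ‖ ≤ ‖φ.comp V.subtypeL‖ * ‖(e : H →L[ℝ] V).comp A‖ :=
            ContinuousLinearMap.opNorm_comp_le _ _
        _ ≤ ‖φ.comp V.subtypeL‖ := mul_le_of_le_one_right (ContinuousLinearMap.opNorm_nonneg _) hA
        _ ≤ ‖φ‖ * ‖V.subtypeL‖ := ContinuousLinearMap.opNorm_comp_le _ _
        _ ≤ ‖φ‖ := mul_le_of_le_one_right (norm_nonneg _) V.norm_subtypeL_le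
    have hB := hu.sum_inner_products_le (s := Finset.univ) ((InnerProductSpace.toDual ℝ H).symm ψ)
    have hB' : ∑ i, ψ (u i) ^ 2 ≤ ‖φ‖ ^ 2 := by
      refine le_trans (le_of_eq_of_le ?_ hB) ?_
      · refine Finset.sum_congr rfl fun i _ => ?_
        rw [real_inner_comm, InnerProductSpace.toDual_symm_apply, Real.norm_eq_abs, sq_abs]
      · rw [LinearIsometryEquiv.norm_map]
        exact pow_le_pow_left₀ (norm_nonneg _) hψ 2
    calc ∑ i, φ (‖e (A (u i))‖⁻¹ • (e (A (u i)) : X)) ^ 2 ≤ ∑ i, 9 * ψ (u i) ^ 2 := by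
          refine Finset.sum_le_sum fun i _ => ?_
          have h9 : (‖e (A (u i))‖⁻¹) ^ 2 ≤ 9 := by
            have := pow_le_pow_left₀ (inv_nonneg.2 (norm_nonneg _))
              (inv_anti₀ (by norm_num) (hpu i)) 2
            norm_num at this ⊢
            exact this
          rw [map_smul, smul_eq_mul, mul_pow]
          exact mul_le_mul_of_nonneg_right h9 (sq_nonneg _)
      _ ≤ 9 * ‖φ‖ ^ 2 := by
        rw [← Finset.mul_sum]
        linarith

end DvoretzkyRogers

/-! ### Dense eventual kernels and separable quotients. -/

section EventualKernel

variable {E : Type*} [NormedAddCommGroup E] [NormedSpace ℝ E]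

theorem mem_eventualKernel {f : ℕ → StrongDual ℝ E} {x : E} :
    x ∈ eventualKernel f ↔ ∀ᶠ n in atTop, f n x = 0 := by
  simp [eventualKernel, eventually_atTop]

theorem HasInfiniteDimensionalSeparableQuotient.of_dense_eventualKernel
    {f : ℕ → StrongDual ℝ E} (hf : ∀ n, f n ≠ 0) (hd : Dense (eventualKernel f)) :
    HasInfiniteDimensionalSeparableQuotient E := by
  let W : Submodule ℝ E := ⨅ n, (f n).ker
  have hWmem : ∀ x, x ∈ W ↔ ∀ n, f n x = 0 := fun x => by simp [W]
  have hWc : IsClosed (W : Set E) := by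
    rw [Submodule.coe_iInf]
    exact isClosed_iInter fun n => (f n).isClosed_ker
  let S : ℕ → Submodule ℝ E := fun m => ⨅ n, ⨅ _ : m ≤ n, (f n).ker
  have hSmem : ∀ m x, x ∈ S m ↔ ∀ n, m ≤ n → f n x = 0 := fun m x => by
    simp [S, Submodule.mem_iInf]
  have hSmono : Monotone S := fun m k hmk x hx =>
    (hSmem k x).2 fun n hn => (hSmem m x).1 hx n (hmk.trans hn)
  let Q : ℕ →o Submodule ℝ (E ⧸ W) :=
    ⟨fun m => (S m).map W.mkQ, fun m k hmk => Submodule.map_mono (hSmono hmk)⟩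
  have hQdense : Dense (⋃ m, (Q m : Set (E ⧸ W))) := by
    refine ((Function.Surjective.denseRange W.mkQ_surjective).dense_image
      W.mkQL.continuous hd).mono ?_
    rintro _ ⟨x, hx, rfl⟩
    obtain ⟨m, hm⟩ := eventually_atTop.1 (mem_eventualKernel.1 hx)
    exact mem_iUnion.2 ⟨m, Submodule.mem_map_of_mem ((hSmem m x).2 hm)⟩
  refine ⟨W, hWc, ?_, fun hfin => ?_⟩
  · have hQfin : ∀ m, FiniteDimensional ℝ (Q m) := by
      intro m
      -- On `S m` only the first `m` functionals can be non-zero, so they separate points modulo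
      -- `W`.
      let Φ : (E ⧸ W) →ₗ[ℝ] (Fin m → ℝ) :=
        W.liftQ (LinearMap.pi fun i => (f i : E →ₗ[ℝ] ℝ)) fun x hx => by
          ext i
          exact (hWmem x).1 hx i
      refine Module.Finite.of_injective (Φ.domRestrict (Q m)) ?_
      rw [← LinearMap.ker_eq_bot, LinearMap.ker_eq_bot']
      rintro ⟨_, x, hx, rfl⟩ h0
      refine Subtype.ext ((Submodule.Quotient.mk_eq_zero W).2 ((hWmem x).2 fun n => ?_))
      rcases lt_or_ge n m with hn | hn
      · exact congrFun h0 ⟨n, hn⟩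
      · exact (hSmem m x).1 hx n hn
    have hsep : TopologicalSpace.IsSeparable (⋃ m, (Q m : Set (E ⧸ W))) := by
      refine TopologicalSpace.IsSeparable.iUnion fun m => ?_
      have : IsClosed (W : Set E) := hWc
      have := hQfin m
      have : ProperSpace (Q m) := FiniteDimensional.proper_real _
      exact TopologicalSpace.IsSeparable.of_subtype _
    have := hsep.closure
    rw [hQdense.closure_eq] at this
    exact TopologicalSpace.isSeparable_univ_iff.1 this
  · have : IsClosed (W : Set E) := hWc
    obtain ⟨m, hm⟩ := monotone_stabilizes_iff_noetherian.2
      (inferInstance : IsNoetherian ℝ (E ⧸ W)) Q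
    have hQm : Dense (Q m : Set (E ⧸ W)) := hQdense.mono <| iUnion_subset fun k => by
      rcases le_total m k with h | h
      · rw [hm k h]
      · exact Q.monotone h
    have htop : ∀ y, y ∈ Q m := fun y =>
      (Submodule.closed_of_finiteDimensional (Q m)).closure_subset (hQm y)
    refine hf m (ContinuousLinearMap.ext fun x => ?_)
    obtain ⟨z, hz, hzx⟩ := htop (W.mkQ x)
    have h1 : z - x ∈ W := (Submodule.Quotient.eq W).1 hzx
    have h2 := (hWmem _).1 h1 m
    rw [map_sub, (hSmem m z).1 hz m le_rfl, zero_sub, neg_eq_zero] at h2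
    exact h2

/-- Finitely many further conditions cut `G` by finite codimension, so otherwise `G` is
finite-dimensional; but `B` embeds `M ⧸ W` in the dual of `G`. -/
theorem not_finiteDimensional_inf_ker {M X : Type*} [AddCommGroup M] [Module ℝ M]
    [AddCommGroup X] [Module ℝ X] (B : M →ₗ[ℝ] X →ₗ[ℝ] ℝ) (W : Submodule ℝ M)
    (G : Submodule ℝ X) (hWG : ∀ w ∈ W, ∀ g ∈ G, B w g = 0)
    (hGW : ∀ x, (∀ g ∈ G, B x g = 0) → x ∈ W) (hinf : ¬ FiniteDimensional ℝ (M ⧸ W))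
    {k : ℕ} (ℓ : X →ₗ[ℝ] (Fin k → ℝ)) :
    ¬ FiniteDimensional ℝ (G ⊓ ℓ.ker : Submodule ℝ X) := by
  intro hfin
  let ev : G →ₗ[ℝ] (Fin k → ℝ) := ℓ.comp G.subtype
  have hker : FiniteDimensional ℝ ev.ker := by
    let j : ev.ker →ₗ[ℝ] (G ⊓ ℓ.ker : Submodule ℝ X) :=
      (G.subtype.comp ev.ker.subtype).codRestrict _ fun f => ⟨f.1.2, f.2⟩
    refine Module.Finite.of_injective j fun f g hfg => ?_
    exact Subtype.ext (Subtype.ext (congrArg (fun z : (G ⊓ ℓ.ker : Submodule ℝ X) => (z : X)) hfg))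
  have hquot : FiniteDimensional ℝ (G ⧸ ev.ker) :=
    Module.Finite.equiv ev.quotKerEquivRange.symm
  have hG : FiniteDimensional ℝ G := Module.Finite.of_submodule_quotient ev.ker
  let Ψ : M →ₗ[ℝ] Module.Dual ℝ G := B.compl₂ G.subtype
  refine hinf (Module.Finite.of_injective (W.liftQ Ψ fun w hw => ?_) ?_)
  · ext f
    exact hWG w hw f.1 f.2
  · rw [← LinearMap.ker_eq_bot, LinearMap.ker_eq_bot']
    intro q hq
    obtain ⟨x, rfl⟩ := W.mkQ_surjective q
    exact (Submodule.Quotient.mk_eq_zero W).2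
      (hGW x fun g hg => LinearMap.congr_fun hq (⟨g, hg⟩ : G))

/-- The continuous linear functionals vanishing on a subspace. -/
def continuousAnnihilator (W : Submodule ℝ E) : Submodule ℝ (StrongDual ℝ E) where
  carrier := {f | ∀ w ∈ W, f w = 0}
  zero_mem' := by simp
  add_mem' hf hg := fun w hw => by simp [hf w hw, hg w hw]
  smul_mem' c f hf := fun w hw => by simp [hf w hw]

theorem mem_of_forall_continuousAnnihilator {W : Submodule ℝ E} (hW : IsClosed (W : Set E))
    {x : E} (hx : ∀ f ∈ continuousAnnihilator W, f x = 0) : x ∈ W := by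
  have : IsClosed (W : Set E) := hW
  by_contra hne
  obtain ⟨g, hg⟩ := SeparatingDual.exists_ne_zero (R := ℝ)
    (mt (Submodule.Quotient.mk_eq_zero W).1 hne)
  refine hg (hx (g.comp W.mkQL) fun w hw => ?_)
  change g (W.mkQ w) = 0
  rw [Submodule.mkQ_apply, (Submodule.Quotient.mk_eq_zero W).2 hw, map_zero]

theorem HasInfiniteDimensionalSeparableQuotient.exists_submodules
    (h : HasInfiniteDimensionalSeparableQuotient E) :
    ∃ F : ℕ → Submodule ℝ (StrongDual ℝ E), (∀ k, ¬ FiniteDimensional ℝ (F k)) ∧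
      Antitone F ∧ ∀ f : ℕ → StrongDual ℝ E, (∀ k, ∀ᶠ n in atTop, f n ∈ F k) →
        Dense (eventualKernel f) := by
  obtain ⟨W, hW, hsep, hinf⟩ := h
  choose y hy using fun n => W.mkQ_surjective (TopologicalSpace.denseSeq (E ⧸ W) n)
  let ℓ : ∀ k, StrongDual ℝ E →ₗ[ℝ] (Fin k → ℝ) := fun k =>
    { toFun := fun f i => f (y i)
      map_add' := fun _ _ => rfl
      map_smul' := fun _ _ => rfl }
  let B : E →ₗ[ℝ] StrongDual ℝ E →ₗ[ℝ] ℝ :=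
    LinearMap.mk₂ ℝ (fun x f => f x) (fun x x' f => map_add f x x')
      (fun c x f => map_smul f c x) (fun _ _ _ => rfl) (fun _ _ _ => rfl)
  refine ⟨fun k => continuousAnnihilator W ⊓ (ℓ k).ker, fun k =>
    not_finiteDimensional_inf_ker B W (continuousAnnihilator W) (fun w hw g hg => hg w hw)
      (fun x hx => mem_of_forall_continuousAnnihilator hW hx) hinf (ℓ k),
    fun k m hkm f hf => ⟨hf.1, funext fun i =>
      congrFun (LinearMap.mem_ker.1 hf.2) (Fin.castLE hkm i)⟩, fun f hf => ?_⟩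
  -- The cosets `y i + W` have dense union because the quotient map is open.
  refine ((TopologicalSpace.denseRange_denseSeq (E ⧸ W)).preimage W.isOpenMap_mkQ).mono ?_
  rintro x ⟨i, hi⟩
  rw [mem_eventualKernel]
  filter_upwards [hf (i + 1)] with n hn
  have h1 : x - y i ∈ W := (Submodule.Quotient.eq W).1 (hi.symm.trans (hy i).symm)
  have h2 := hn.1 _ h1
  have h3 : f n (y i) = 0 := congrFun (LinearMap.mem_ker.1 hn.2) (Fin.last i)
  rwa [map_sub, h3, sub_zero] at h2

end EventualKernel

/-! ### Selecting vectors from the `F k`, and the speed `κ` of the selection. -/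

theorem exists_linearIndependent_mem {X : Type*} [AddCommGroup X] [Module ℝ X]
    (F : ℕ → Submodule ℝ X) (hF : ∀ k, ¬ FiniteDimensional ℝ (F k)) :
    ∃ f : ℕ → X, LinearIndependent ℝ f ∧ ∀ n, f n ∈ F n := by
  classical
  have hpick : ∀ (n : ℕ) (s : Finset X), ∃ x ∈ F n, x ∉ Submodule.span ℝ (s : Set X) := by
    intro n s
    by_contra! hle
    exact hF n (Submodule.finiteDimensional_of_le (S₂ := Submodule.span ℝ (s : Set X)) hle)
  choose pick hmem hnot using hpick
  let s : ℕ → Finset X := fun n => Nat.rec ∅ (fun k t => insert (pick k t) t) n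
  have hs : ∀ n, s (n + 1) = insert (pick n (s n)) (s n) := fun n => rfl
  have himage : ∀ n, (fun k => pick k (s k)) '' Iio n = SetLike.coe (s n) := by
    intro n
    induction n with
    | zero => simp [s]
    | succ n ih =>
      have : Iio (n + 1) = insert n (Iio n) := by
        ext k
        simp only [mem_Iio, mem_insert_iff]
        omega
      rw [hs, Finset.coe_insert, ← ih, this, image_insert_eq]
  refine ⟨fun k => pick k (s k), ?_, fun n => hmem _ _⟩
  have hind : ∀ n, LinearIndepOn ℝ (fun k => pick k (s k)) (Iio n) := by
    intro n
    induction n with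
    | zero =>
      have : Iio 0 = (∅ : Set ℕ) := by ext; simp
      rw [this]
      exact linearIndepOn_empty _ _
    | succ n ih =>
      have : Iio (n + 1) = insert n (Iio n) := by
        ext k
        simp only [mem_Iio, mem_insert_iff]
        omega
      rw [this]
      exact ih.insert (by rw [himage]; exact hnot _ _)
  have hU := linearIndepOn_iUnion_of_directed
    (directed_of_isDirected_le fun m n h => Iio_subset_Iio h) hind
  rwa [iUnion_Iio, linearIndepOn_univ_iff] at hU

theorem exists_unit_vectors_weighted_summable {X : Type*} [NormedAddCommGroup X]
    [NormedSpace ℝ X] (F : ℕ → Submodule ℝ X) (hF : ∀ k, ¬ FiniteDimensional ℝ (F k))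
    {κ : ℕ → ℕ} (hκ : Tendsto κ atTop atTop) :
    ∃ x : ℕ → X, (∀ n, ‖x n‖ = 1) ∧ (∀ n, x n ∈ F (κ n)) ∧
      ∀ φ : StrongDual ℝ X, Summable fun n => (1 / 2 : ℝ) ^ κ n * φ (x n) ^ 2 := by
  have hN : ∀ k, ∃ N, ∀ n, κ n = k → n < N := by
    intro k
    obtain ⟨N, hN⟩ := eventually_atTop.1 (hκ.eventually_gt_atTop k)
    refine ⟨N, fun n hn => ?_⟩
    by_contra! h
    have := hN n h
    omega
  choose N hN using hN
  choose e he1 he2 using fun k => exists_unit_vectors_sum_sq_le (hF k) (N k)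
  -- The index `n` itself serves as position in block `κ n`, so no position is used twice; the
  -- weight `(1 / 2) ^ k` makes the block bounds summable.
  refine ⟨fun n => (e (κ n) ⟨n, hN _ n rfl⟩ : X), fun n => he1 _ _, fun n => Subtype.coe_prop _,
    fun φ => ?_⟩
  set x : ℕ → X := fun n => (e (κ n) ⟨n, hN _ n rfl⟩ : X) with hx
  have hblock : ∀ k (s : Finset ℕ), ∑ n ∈ s with κ n = k, φ (x n) ^ 2 ≤ 9 * ‖φ‖ ^ 2 := by
    intro k s
    have h1 : ‖φ.comp (F k).subtypeL‖ ≤ ‖φ‖ :=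
      (ContinuousLinearMap.opNorm_comp_le _ _).trans
        (mul_le_of_le_one_right (norm_nonneg _) (F k).norm_subtypeL_le)
    calc ∑ n ∈ s with κ n = k, φ (x n) ^ 2
        ≤ ∑ i : Fin (N k), (φ.comp (F k).subtypeL) (e k i) ^ 2 := by
          let g : ℕ → ℝ := fun n => if h : n < N k then φ (e k ⟨n, h⟩) ^ 2 else 0
          have hg : ∀ n, 0 ≤ g n := fun n => by
            dsimp only [g]
            split_ifs <;> positivity
          calc ∑ n ∈ s with κ n = k, φ (x n) ^ 2 = ∑ n ∈ s with κ n = k, g n := by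
                refine Finset.sum_congr rfl fun n hn => ?_
                obtain rfl := (Finset.mem_filter.1 hn).2
                simp [g, hx, hN _ n rfl]
            _ ≤ ∑ n ∈ Finset.range (N k), g n :=
              Finset.sum_le_sum_of_subset_of_nonneg
                (fun n hn => Finset.mem_range.2 (hN k n (Finset.mem_filter.1 hn).2))
                (fun n _ _ => hg n)
            _ = ∑ i : Fin (N k), (φ.comp (F k).subtypeL) (e k i) ^ 2 := by
              rw [Finset.sum_range]
              refine Finset.sum_congr rfl fun i _ => ?_
              simp [g]
      _ ≤ 9 * ‖φ.comp (F k).subtypeL‖ ^ 2 := he2 k _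
      _ ≤ 9 * ‖φ‖ ^ 2 := by gcongr
  have hgeom : Summable fun k : ℕ => (1 / 2 : ℝ) ^ k * (9 * ‖φ‖ ^ 2) :=
    summable_geometric_two.mul_right _
  refine summable_of_sum_range_le (c := ∑' k : ℕ, (1 / 2 : ℝ) ^ k * (9 * ‖φ‖ ^ 2))
    (fun n => by positivity) fun M => ?_
  rw [← Finset.sum_fiberwise_of_maps_to (t := (Finset.range M).image κ) (g := κ)
    (fun n hn => Finset.mem_image_of_mem κ hn)]
  refine le_trans (Finset.sum_le_sum fun k _ => ?_)
    (hgeom.sum_le_tsum _ fun k _ => by positivity)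
  calc ∑ n ∈ Finset.range M with κ n = k, (1 / 2 : ℝ) ^ κ n * φ (x n) ^ 2
      = (1 / 2 : ℝ) ^ k * ∑ n ∈ Finset.range M with κ n = k, φ (x n) ^ 2 := by
        rw [Finset.mul_sum]
        refine Finset.sum_congr rfl fun n hn => ?_
        rw [(Finset.mem_filter.1 hn).2]
    _ ≤ _ := mul_le_mul_of_nonneg_left (hblock k _) (by positivity)

theorem exists_tendsto_atTop_two_pow_mul_le {d : ℕ → ℝ} (hd : Tendsto d atTop (𝓝 0)) :
    ∃ κ : ℕ → ℕ, Tendsto κ atTop atTop ∧ ∃ B, ∀ n, 2 ^ κ n * d n ≤ B := by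
  classical
  let κ : ℕ → ℕ := fun n => Nat.findGreatest (fun k => 2 ^ k * d n ≤ 1) n
  refine ⟨κ, tendsto_atTop.2 fun k => ?_, ?_⟩
  · have h1 : ∀ᶠ n in atTop, 2 ^ k * d n ≤ 1 := by
      have := hd.const_mul (2 ^ k)
      rw [mul_zero] at this
      exact this.eventually_le_const one_pos
    filter_upwards [h1, eventually_ge_atTop k] with n hn hk
    exact Nat.le_findGreatest hk hn
  · obtain ⟨B, hB⟩ := hd.bddAbove_range
    refine ⟨max B 1, fun n => ?_⟩
    -- `Nat.findGreatest` also returns 0 when no exponent works; `d n ≤ B` covers this.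
    rcases eq_or_ne (κ n) 0 with h | h
    · rw [h, pow_zero, one_mul]
      exact (hB ⟨n, rfl⟩).trans (le_max_left _ _)
    · exact (Nat.findGreatest_of_ne_zero (P := fun k => 2 ^ k * d n ≤ 1) rfl h).trans
        (le_max_right _ _)

/-- With `r` the tails of the series, `a n / √(r n)` is still summable by telescoping `√(r n)`, so
`2 ^ κ n` may grow like `1 / √(r n)`. -/
theorem exists_tendsto_atTop_summable_two_pow_mul {a : ℕ → ℝ} (ha : Summable a)
    (h0 : ∀ n, 0 ≤ a n) :
    ∃ κ : ℕ → ℕ, Tendsto κ atTop atTop ∧ Summable fun n => 2 ^ κ n * a n := by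
  set r : ℕ → ℝ := fun n => ∑' k, a (k + n)
  have hr0 : ∀ n, 0 ≤ r n := fun n => tsum_nonneg fun k => h0 _
  have hr : ∀ n, r n = a n + r (n + 1) := by
    intro n
    have := ((summable_nat_add_iff n).2 ha).tsum_eq_zero_add
    simpa [r, add_assoc, add_comm 1 n] using this
  have hlim : Tendsto (fun n => √(r n)) atTop (𝓝 0) := by
    simpa using (tendsto_sum_nat_add a).sqrt
  obtain ⟨κ, hκ, B, hB⟩ := exists_tendsto_atTop_two_pow_mul_le hlim
  refine ⟨κ, hκ, ?_⟩
  have hB0 : 0 ≤ B := le_trans (by positivity) (hB 0)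
  have hle : ∀ n, 2 ^ κ n * a n ≤ 2 * B * (√(r n) - √(r (n + 1))) := by
    intro n
    have h1 : √(r (n + 1)) ≤ √(r n) := Real.sqrt_le_sqrt (by linarith [hr n, h0 n])
    have h2 : a n = (√(r n) - √(r (n + 1))) * (√(r n) + √(r (n + 1))) := by
      have e1 := Real.mul_self_sqrt (hr0 n)
      have e2 := Real.mul_self_sqrt (hr0 (n + 1))
      linarith [hr n]
    calc 2 ^ κ n * a n
        = (√(r n) - √(r (n + 1))) * (2 ^ κ n * (√(r n) + √(r (n + 1)))) := by
          nth_rewrite 1 [h2]; ring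
      _ ≤ (√(r n) - √(r (n + 1))) * (2 * B) := by
        refine mul_le_mul_of_nonneg_left ?_ (sub_nonneg.2 h1)
        have : 2 ^ κ n * √(r (n + 1)) ≤ 2 ^ κ n * √(r n) :=
          mul_le_mul_of_nonneg_left h1 (by positivity)
        linarith [hB n]
      _ = _ := mul_comm _ _
  refine summable_of_sum_range_le (c := 2 * B * √(r 0))
    (fun n => mul_nonneg (by positivity) (h0 n)) fun M => ?_
  refine (Finset.sum_le_sum fun n _ => hle n).trans ?_
  rw [← Finset.mul_sum, Finset.sum_range_sub' (fun n => √(r n))]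
  exact mul_le_mul_of_nonneg_left (by linarith [Real.sqrt_nonneg (r M)]) (by positivity)

/-! ### From weighted square sums to weak summability. -/

section Scaling

variable {X : Type*} [NormedAddCommGroup X] [NormedSpace ℝ X]

theorem WeaklySummable.smul_of_summable {κ : ℕ → ℕ} {x : ℕ → X} {c : ℕ → ℝ}
    (hx : ∀ φ : StrongDual ℝ X, Summable fun n => (1 / 2 : ℝ) ^ κ n * φ (x n) ^ 2)
    (hc : Summable fun n => 2 ^ κ n * c n ^ 2) :
    WeaklySummable 1 fun n => c n • x n := by
  intro φ
  rw [memℓp_gen_iff (by simp)]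
  refine Summable.of_nonneg_of_le (fun n => by positivity) (fun n => ?_) (hc.add (hx φ))
  rw [ENNReal.toReal_one, Real.rpow_one, map_smul, smul_eq_mul, Real.norm_eq_abs, abs_mul]
  have h1 : (2 : ℝ) ^ κ n * (1 / 2 : ℝ) ^ κ n = 1 := by rw [← mul_pow]; norm_num
  have h2 : 0 < (1 / 2 : ℝ) ^ κ n := by positivity
  have h3 : (0 : ℝ) < 2 ^ κ n := by positivity
  -- Weighted AM-GM: `2 * |c| * |φ x| ≤ 2 ^ κ * c ^ 2 + (1 / 2) ^ κ * φ x ^ 2`.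
  have h4 : 0 ≤ (1 / 2 : ℝ) ^ κ n * (2 ^ κ n * |c n| - |φ (x n)|) ^ 2 := by positivity
  have h5 : (1 / 2 : ℝ) ^ κ n * (2 ^ κ n * |c n| - |φ (x n)|) ^ 2 =
      (2 ^ κ n * (1 / 2 : ℝ) ^ κ n) * (2 ^ κ n * |c n| ^ 2) -
        2 * (2 ^ κ n * (1 / 2 : ℝ) ^ κ n) * (|c n| * |φ (x n)|) +
        (1 / 2 : ℝ) ^ κ n * |φ (x n)| ^ 2 := by ring
  rw [h5, h1, sq_abs, sq_abs] at h4
  nlinarith [abs_nonneg (c n), abs_nonneg (φ (x n)),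
    mul_nonneg (abs_nonneg (c n)) (abs_nonneg (φ (x n)))]

theorem WeaklySummable.smul_of_bounded {κ : ℕ → ℕ} {x : ℕ → X} {c : ℕ → ℝ} {B : ℝ}
    (hx : ∀ φ : StrongDual ℝ X, Summable fun n => (1 / 2 : ℝ) ^ κ n * φ (x n) ^ 2)
    (hc : ∀ n, 2 ^ κ n * c n ^ 2 ≤ B) :
    WeaklySummable 2 fun n => c n • x n := by
  intro φ
  rw [memℓp_gen_iff (by simp)]
  refine Summable.of_nonneg_of_le (fun n => by positivity) (fun n => ?_) ((hx φ).mul_left B)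
  rw [ENNReal.toReal_ofNat, Real.rpow_ofNat, map_smul, smul_eq_mul, Real.norm_eq_abs, sq_abs,
    mul_pow]
  have h1 : (2 : ℝ) ^ κ n * (1 / 2 : ℝ) ^ κ n = 1 := by rw [← mul_pow]; norm_num
  have h2 : 0 ≤ (1 / 2 : ℝ) ^ κ n * φ (x n) ^ 2 := by positivity
  calc c n ^ 2 * φ (x n) ^ 2
      = (2 ^ κ n * (1 / 2 : ℝ) ^ κ n) * (c n ^ 2 * φ (x n) ^ 2) := by rw [h1, one_mul]
    _ = (2 ^ κ n * c n ^ 2) * ((1 / 2 : ℝ) ^ κ n * φ (x n) ^ 2) := by ring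
    _ ≤ _ := mul_le_mul_of_nonneg_right (hc n) h2

end Scaling

/-! ### Assembling the equivalences. -/

theorem HasInfiniteDimensionalSeparableQuotient.exists_unit_functionals {E : Type*}
    [NormedAddCommGroup E] [NormedSpace ℝ E] (h : HasInfiniteDimensionalSeparableQuotient E)
    {κ : ℕ → ℕ} (hκ : Tendsto κ atTop atTop) (c : ℕ → ℝ) (hc : ∀ n, 0 ≤ c n) :
    ∃ x : ℕ → StrongDual ℝ E, (∀ n, ‖c n • x n‖ = c n) ∧
      Dense (eventualKernel fun n => c n • x n) ∧
      ∀ φ : StrongDual ℝ (StrongDual ℝ E),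
        Summable fun n => (1 / 2 : ℝ) ^ κ n * φ (x n) ^ 2 := by
  obtain ⟨F, hF, hanti, hd⟩ := h.exists_submodules
  obtain ⟨x, hx1, hxF, hx⟩ := exists_unit_vectors_weighted_summable F hF hκ
  refine ⟨x, fun n => ?_, hd _ fun k => ?_, hx⟩
  · rw [norm_smul, hx1, mul_one, Real.norm_of_nonneg (hc n)]
  · filter_upwards [hκ.eventually_ge_atTop k] with n hn
    exact (F k).smul_mem _ (hanti hn (hxF n))

theorem mainTheorem5 (E : Type*) [NormedAddCommGroup E] [NormedSpace ℝ E] [CompleteSpace E] :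
    List.TFAE [
      ∀ c : ℕ → ℝ, Memℓp c 2 → (∀ n, 0 ≤ c n) →
        ∃ f : ℕ → StrongDual ℝ E, WeaklySummable 1 f ∧ (∀ n, ‖f n‖ = c n) ∧
          Dense (eventualKernel f),
      ∀ c : ℕ → ℝ, Tendsto c atTop (𝓝 0) → (∀ n, 0 ≤ c n) →
        ∃ f : ℕ → StrongDual ℝ E, WeaklySummable 2 f ∧ (∀ n, ‖f n‖ = c n) ∧
          Dense (eventualKernel f),
      ∃ f : ℕ → StrongDual ℝ E, LinearIndependent ℝ f ∧ Dense (eventualKernel f),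
      ∃ f : ℕ → StrongDual ℝ E, (∀ n, f n ≠ 0) ∧ Dense (eventualKernel f),
      HasInfiniteDimensionalSeparableQuotient E] := by
  -- The sequence `1 / (n + 1)` lies in both ℓ₂ and c₀ and never vanishes, so (a) and (b) each yield
  -- non-zero functionals.
  have hpos : ∀ n : ℕ, (0 : ℝ) < 1 / ((n : ℝ) + 1) := fun n => by positivity
  tfae_have 1 → 4 := by
    intro h
    obtain ⟨f, -, hf, hd⟩ := h (fun n => 1 / ((n : ℝ) + 1)) (by
      rw [memℓp_gen_iff (by simp)]
      have := (summable_nat_add_iff 1).2 (Real.summable_one_div_nat_pow.2 one_lt_two)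
      simpa using this) (fun n => (hpos n).le)
    exact ⟨f, fun n => norm_pos_iff.1 ((hf n).symm ▸ hpos n), hd⟩
  tfae_have 2 → 4 := by
    intro h
    obtain ⟨f, -, hf, hd⟩ := h (fun n => 1 / ((n : ℝ) + 1))
      tendsto_one_div_add_atTop_nhds_zero_nat (fun n => (hpos n).le)
    exact ⟨f, fun n => norm_pos_iff.1 ((hf n).symm ▸ hpos n), hd⟩
  tfae_have 3 → 4 := fun ⟨f, hf, hd⟩ => ⟨f, hf.ne_zero, hd⟩
  tfae_have 4 → 5 := fun ⟨_, hf, hd⟩ =>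
    HasInfiniteDimensionalSeparableQuotient.of_dense_eventualKernel hf hd
  tfae_have 5 → 3 := by
    intro h
    obtain ⟨F, hF, hanti, hd⟩ := h.exists_submodules
    obtain ⟨f, hf, hfF⟩ := exists_linearIndependent_mem F hF
    exact ⟨f, hf, hd f fun k => (eventually_ge_atTop k).mono fun n hn => hanti hn (hfF n)⟩
  tfae_have 5 → 1 := by
    intro h c hc hc0
    rw [memℓp_gen_iff (by simp)] at hc
    obtain ⟨κ, hκ, hsum⟩ := exists_tendsto_atTop_summable_two_pow_mul (a := fun n => c n ^ 2)
      (by simpa using hc) (fun n => sq_nonneg _)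
    obtain ⟨x, hnorm, hd, hx⟩ := h.exists_unit_functionals hκ c hc0
    exact ⟨_, WeaklySummable.smul_of_summable hx hsum, hnorm, hd⟩
  tfae_have 5 → 2 := by
    intro h c hc hc0
    obtain ⟨κ, hκ, B, hB⟩ := exists_tendsto_atTop_two_pow_mul_le (d := fun n => c n ^ 2)
      (by simpa using hc.pow 2)
    obtain ⟨x, hnorm, hd, hx⟩ := h.exists_unit_functionals hκ c hc0
    exact ⟨_, WeaklySummable.smul_of_bounded hx hB, hnorm, hd⟩
  tfae_finish
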